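/- **Setting.** A tree is a partially ordered set $(T,\preceq)$ in which, for every node $a$, the set $\{b: b\prec a\}$ is finite and linearly ordered; the level of $a$ is $\ell(a)=|\{b:b\prec a\}|$, and $T(i)$, $T(<i)$, $T(\le i)$ are the sets of nodes of level $=i$, $<i$, $\le i$. An $\mathcal S$-tree $(T,\preceq,\Sigma,\mathcal S)$ is a countable finitely branching tree with finitely many nodes of level $0$, a set $\Sigma$, and a partial function $\mathcal S\colon T\times T^{<\omega}\times\Sigma\to T$ such that * (S1) if $\mathcal S(a,\bar p,c)$ is defined, then it is an immediate successor of $a$ and all entries of $\bar p$ have level at most $\ell(a)-1$; * (S2) if $\mathcal S(a,\bar p,c)=\mathcal S(b,\bar q,d)$, then $a=b$, $\bar p=\bar q$, $c=d$; * (S3) every immediate successor $b$ of a node $a$ equals $\mathcal S(a,\bar p,c)$ for some $\bar p$ and $c$. An injection $F\colon T\to T$ is shape-preserving if (i) $\ell(a)=\ell(b)$ implies $\ell(F(a))=\ell(F(b))$; (ii) whenever $\mathcal S(a,\bar p,c)$ is defined, $\mathcal S(F(a),F(\bar p),c)$ is defined and $\mathcal S(F(a),F(\bar p),c)\preceq F(\mathcal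 S(a,\bar p,c))$; (iii) $a\in T(0)$ and $a\preceq b$ imply $a\preceq F(b)$. For a function $f$ satisfying (i) on its domain, $\tilde f(i)$ is the level of $f(a)$ for any $a$ of level $i$ in its domain. $F$ skips level $m$ if $m$ is not a value of $\tilde F$, and skips only level $m$ if the set of values of $\tilde F$ is $\omega\setminus\{m\}$. An $(\mathcal S,\mathcal M)$-tree is an $\mathcal S$-tree with a set $\mathcal M$ of shape-preserving functions $T\to T$ such that * (M1) $\mathcal M$ contains the identity and is closed under composition, and for every sequence $(F_i)_{i\in\omega}$ in $\mathcal M$ with $F_i\restriction_{T(\le i)}=F_{i+1}\restriction_{T(\le i)}$ for all $i$ there is $F_\infty\in\mathcal M$ with $F_\infty\restriction_{T(\le i)}=F_i\restriction_{T(\le i)}$ for all $i$; * (M2) for every $n\in\omega$ and every $F\in\mathcal M$ with $\tilde F(n)>0$ that skips level $\tilde F(n)-1$ there are $F_1,F_2\in\mathcal M$ such that $F_2$ skips only level $\tilde F(n)-1$ and $F_2\circ F_1\restriction_{T(\le n)}=F\restriction_{T(\le n)}$; * (M3) for all $n<m$ there is $F^n_m\in\mathcal M$ skipping only level $m$ such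 that $F^n_m(b)=\mathcal S(b,\bar p,c)$ whenever $a\in T(n)$, $b\in T(m)$, $\mathcal S(a,\bar p,c)$ is defined and $\mathcal S(a,\bar p,c)\preceq b$. Let $\mathcal{AM}^n_k$ be the set of restrictions $F\restriction_{T(<n+k)}$ of those $F\in\mathcal M$ that are the identity on $T(<n)$, and, for $n+k>0$, let $\mathcal{AM}^n_k(j)=\{f\in\mathcal{AM}^n_k:\tilde f(n+k-1)=j\}$. **Corollary.** Let $(T,\preceq,\Sigma,\mathcal S,\mathcal M)$ be an $(\mathcal S,\mathcal M)$-tree. Then for all $n,k,m,r\in\omega$ with $n+k>0$ and $n+m>0$ there exists $N\in\omega$ such that for every $r$-colouring $\chi\colon\mathcal{AM}^n_k(N)\to r$ there exists $F\in\mathcal{AM}^n_m(N)$ such that, for every $g\in\mathcal{AM}^n_k(n+m-1)$, the composition $F\circ g$ is defined and belongs to $\mathcal{AM}^n_k(N)$, and $\chi$ is constant on $$\{F\circ g: g\in\mathcal{AM}^n_k(n+m-1)\}.$$ -/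

import Mathlib

namespace ShapeRamsey

universe u v

/-- The level `ℓ(a)` of a node: the number of its strict predecessors. -/
noncomputable def level {T : Type u} [PartialOrder T] (a : T) : ℕ := (Set.Iio a).ncard

/-- The part `T(<k)` of a tree below level `k`. -/
abbrev Below (T : Type u) [PartialOrder T] (k : ℕ) : Type u := {a : T // level a < k}

/-- An `S`-tree on a partially ordered set `T` with alphabet `A`. The successor operation is a
partial function: `succ a p c = some b` means that it is defined at `(a, p, c)` with value `b`. -/
structure STree (T : Type u) [PartialOrder T] (A : Type v) where
  /-- the successor operation, applied to a base, a parameter and a character -/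
  succ : T → List T → A → Option T
  finite_Iio : ∀ a : T, (Set.Iio a).Finite
  chain_Iio : ∀ a : T, IsChain (· ≤ ·) (Set.Iio a)
  countable : Countable T
  finite_branching : ∀ a : T, {b : T | a ⋖ b}.Finite
  finite_roots : {a : T | level a = 0}.Finite
  covBy_of_succ : ∀ a p c b, succ a p c = some b → a ⋖ b
  level_param_lt : ∀ a p c b, succ a p c = some b → ∀ q ∈ p, level q < level a
  injective : ∀ a p c a' p' c' b, succ a p c = some b → succ a' p' c' = some b →
    a = a' ∧ p = p' ∧ c = c'
  constructive : ∀ a b : T, a ⋖ b → ∃ p c, succ a p c = some b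

variable {T : Type u} [PartialOrder T] {A : Type v}

/-- Shape-preserving functions `T → T`. -/
structure STree.IsShapePreserving (S : STree T A) (F : T → T) : Prop where
  injective : Function.Injective F
  level_preserving : ∀ a b : T, level a = level b → level (F a) = level (F b)
  weakly_preserving : ∀ a p c b, S.succ a p c = some b →
    ∃ b', S.succ (F a) (p.map F) c = some b' ∧ b' ≤ F b
  root_preserving : ∀ a b : T, level a = 0 → a ≤ b → a ≤ F b

/-- The graph of the level function of `F : T → T`: some node of level `i` is mapped to level `j`. -/
def LevelMap (F : T → T) (i j : ℕ) : Prop := ∃ a : T, level a = i ∧ level (F a) = j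

/-- `F` skips level `m`. -/
def Skips (F : T → T) (m : ℕ) : Prop := ∀ i, ¬ LevelMap F i m

/-- `F` skips only level `m`: the levels reached by `F` are exactly the levels other than `m`. -/
def SkipsOnly (F : T → T) (m : ℕ) : Prop := {j : ℕ | ∃ i, LevelMap F i j} = {m}ᶜ

/-- An `(S, M)`-tree. -/
structure SMTree (T : Type u) [PartialOrder T] (A : Type v) extends STree T A where
  /-- the monoid of shape-preserving functions -/
  M : Set (T → T)
  shape_preserving : ∀ F ∈ M, toSTree.IsShapePreserving F
  id_mem : id ∈ M
  comp_mem : ∀ F ∈ M, ∀ F' ∈ M, F ∘ F' ∈ M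
  limit_mem : ∀ F : ℕ → T → T, (∀ i, F i ∈ M) →
    (∀ i, ∀ a : T, level a ≤ i → F i a = F (i + 1) a) →
    ∃ G ∈ M, ∀ i, ∀ a : T, level a ≤ i → G a = F i a
  decomposition : ∀ n j : ℕ, ∀ F ∈ M, LevelMap F n (j + 1) → Skips F j →
    ∃ F₁ ∈ M, ∃ F₂ ∈ M, SkipsOnly F₂ j ∧ ∀ a : T, level a ≤ n → F₂ (F₁ a) = F a
  duplication : ∀ n m : ℕ, n < m → ∃ F ∈ M, SkipsOnly F m ∧
    ∀ a b : T, level a = n → level b = m → ∀ p c s, succ a p c = some s → s ≤ b →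
      succ b p c = some (F b)

/-- The set `M^n` of the members of `M` that are the identity on `T(<n)`. -/
def SMTree.MFix (S : SMTree T A) (n : ℕ) : Set (T → T) :=
  {F | F ∈ S.M ∧ ∀ a : T, level a < n → F a = a}

/-- The set `AM^n_k` of the restrictions of members of `M^n` to `T(<n+k)`. -/
def SMTree.AM (S : SMTree T A) (n k : ℕ) : Set (Below T (n + k) → T) :=
  {f | ∃ F ∈ S.MFix n, ∀ a : Below T (n + k), f a = F a}

/-- The set `AM^n_k(m)` of those `f ∈ AM^n_k` that map the top level `n + k - 1` of their domain
to level `m`. -/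
def SMTree.AMAt (S : SMTree T A) (n k m : ℕ) : Set (Below T (n + k) → T) :=
  {f | f ∈ S.AM n k ∧ ∃ a : Below T (n + k), level a.1 + 1 = n + k ∧ level (f a) = m}

end ShapeRamsey

namespace ShapeRamsey

universe u v

variable {T : Type u} [PartialOrder T] {A : Type v}

/-! The theorem is proved by induction on the number of levels above `n` that a colouring sees.
Colourings are taken on all functions `T → T`, subject to depending only on an initial part of the
tree, so that composition is total.

Structure: at a level where a shape-preserving function leaves no gap, its values are forced by
lower levels (`agree_succ`). With (M2) this lets skipped levels be split off (`exists_decomp`), gaps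
above a level be removed (`exists_tight`), and functions be factored through one another
(`exists_factor`).

Base case: if `e` in `M^n` sends level `n` to `n + 1`, then each `e a` with `a` in `T(n)` is an
immediate successor `S(a, p, c)`; the pairs `(p, c)` form the letter of `e`. There are finitely many
letters. By (M3) they can be appended at will to a function that already contains them all, so words
become functions, and a variable word becomes a function `F` for which `F ∘ e` substitutes the
letter of `e`. A monochromatic Hales-Jewett line gives `exists_mono_succ`. Larger jumps of level `n`
are reduced to this one in `exists_mono_add`, and `exists_mono_lt` makes the colour independent of
the size of the jump.

Inductive step: `exists_end_homogeneous` makes the colour of `g` depend only on `g` restricted to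
`T(≤ n)`, and `exists_mono_lt` then makes it constant. -/

/-- Two functions agree on `T(<n)`. -/
def Agree (n : ℕ) (F G : T → T) : Prop := ∀ a : T, level a < n → F a = G a

theorem Agree.symm {n : ℕ} {F G : T → T} (h : Agree n F G) : Agree n G F :=
  fun a ha => (h a ha).symm

theorem Agree.trans {n : ℕ} {F G H : T → T} (h : Agree n F G) (h' : Agree n G H) : Agree n F H :=
  fun a ha => (h a ha).trans (h' a ha)

theorem Agree.mono {n m : ℕ} {F G : T → T} (h : Agree n F G) (hm : m ≤ n) : Agree m F G :=
  fun a ha => h a (ha.trans_le hm)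

theorem Agree.comp_left {n : ℕ} {F G : T → T} (H : T → T) (h : Agree n F G) :
    Agree n (H ∘ F) (H ∘ G) :=
  fun a ha => congrArg H (h a ha)

/-! ### Levels and predecessors in an `S`-tree. -/

namespace STree

variable (S : STree T A)

include S in
theorem level_lt {a b : T} (h : a < b) : level a < level b := by
  refine Set.ncard_lt_ncard ?_ (S.finite_Iio b)
  refine ⟨fun c hc => lt_trans hc h, fun hc => ?_⟩
  exact lt_irrefl a (hc h)

include S in
theorem eq_of_le_of_level {a b : T} (h : a ≤ b) (hl : level b ≤ level a) : a = b := by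
  rcases h.eq_or_lt with h | h
  · exact h
  · exact absurd (S.level_lt h) (by omega)

include S in
theorem level_covBy {a b : T} (h : a ⋖ b) : level b = level a + 1 := by
  have : Set.Iio b = insert a (Set.Iio a) := by
    ext c
    constructor
    · intro hc
      by_cases hca : c = a
      · exact Or.inl hca
      · rcases S.chain_Iio b hc h.lt hca with h1 | h1
        · exact Or.inr (lt_of_le_of_ne h1 hca)
        · exact absurd hc (h.2 (lt_of_le_of_ne h1 (Ne.symm hca)))
    · rintro (rfl | hc)
      · exact h.lt
      · exact lt_trans hc h.lt
  unfold level
  rw [this, Set.ncard_insert_of_notMem (by simp) (S.finite_Iio a)]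

include S in
theorem exists_covBy {b : T} (h : 0 < level b) : ∃ a, a ⋖ b := by
  have hne : (Set.Iio b).Nonempty := Set.nonempty_of_ncard_ne_zero h.ne'
  obtain ⟨a, ha⟩ := (S.finite_Iio b).exists_maximal hne
  exact ⟨a, ha.prop, fun c hac hcb => absurd (ha.2 hcb hac.le) (not_le_of_gt hac)⟩

theorem exists_succ_eq {b : T} (h : 0 < level b) : ∃ a p c, S.succ a p c = some b := by
  obtain ⟨a, ha⟩ := S.exists_covBy h
  obtain ⟨p, c, hs⟩ := S.constructive a b ha
  exact ⟨a, p, c, hs⟩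

theorem level_succ {a : T} {p : List T} {c : A} {b : T} (h : S.succ a p c = some b) :
    level b = level a + 1 :=
  S.level_covBy (S.covBy_of_succ _ _ _ _ h)

include S in
theorem exists_le_level {b : T} {i : ℕ} (h : i ≤ level b) : ∃ a ≤ b, level a = i := by
  obtain ⟨d, hd⟩ := Nat.exists_eq_add_of_le h
  induction d generalizing b with
  | zero => exact ⟨b, le_rfl, by omega⟩
  | succ d ih =>
    obtain ⟨a, ha⟩ := S.exists_covBy (b := b) (by omega)
    have := S.level_covBy ha
    obtain ⟨x, hx, hl⟩ := ih (b := a) (by omega) (by omega)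
    exact ⟨x, hx.trans ha.le, hl⟩

include S in
theorem eq_of_le_of_le {a a' b : T} (h : a ≤ b) (h' : a' ≤ b) (hl : level a = level a') :
    a = a' := by
  rcases h.eq_or_lt with rfl | h
  · exact (S.eq_of_le_of_level h' hl.le).symm
  rcases h'.eq_or_lt with rfl | h'
  · exact S.eq_of_le_of_level h.le hl.ge
  by_contra hne
  rcases S.chain_Iio b h h' hne with h1 | h1
  · exact hne (S.eq_of_le_of_level h1 hl.ge)
  · exact hne (S.eq_of_le_of_level h1 hl.le).symm

include S in
theorem finite_level (i : ℕ) : {a : T | level a = i}.Finite := by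
  induction i with
  | zero => exact S.finite_roots
  | succ i ih =>
    refine (ih.biUnion (fun a _ => S.finite_branching a)).subset ?_
    intro b hb
    have hb : level b = i + 1 := hb
    obtain ⟨a, ha⟩ := S.exists_covBy (b := b) (by omega)
    have := S.level_covBy ha
    exact Set.mem_biUnion (show level a = i by omega) ha

include S in
theorem finite_level_lt (i : ℕ) : {a : T | level a < i}.Finite :=
  ((Set.finite_Iio i).biUnion (fun j _ => S.finite_level j)).subset
    (fun a ha => Set.mem_biUnion (show level a ∈ Set.Iio i from ha) rfl)

end STree

/-! ### Level functions and rigidity of shape-preserving maps. -/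

namespace SMTree

variable (S : SMTree T A)

include S in
theorem exists_level (i : ℕ) : ∃ a : T, level a = i := by
  obtain ⟨F, -, hF, -⟩ := S.duplication 0 1 one_pos
  -- Only level 1 is skipped, so some node has level `i + 2`; it has a predecessor of level `i`.
  have h : i + 2 ∈ ({1}ᶜ : Set ℕ) := by simp
  rw [← hF] at h
  obtain ⟨_, a, -, ha⟩ := h
  obtain ⟨b, -, hb⟩ := S.exists_le_level (b := F a) (i := i) (by omega)
  exact ⟨b, hb⟩

/-- The level function of `F`. -/
noncomputable def lv (F : T → T) (i : ℕ) : ℕ := level (F (S.exists_level i).choose)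

variable {S}

theorem level_map {F : T → T} (hF : F ∈ S.M) (a : T) : level (F a) = S.lv F (level a) :=
  (S.shape_preserving F hF).level_preserving _ _ (S.exists_level (level a)).choose_spec.symm

theorem lv_id (i : ℕ) : S.lv id i = i := (S.exists_level i).choose_spec

theorem lv_comp {F G : T → T} (hF : F ∈ S.M) (i : ℕ) :
    S.lv (F ∘ G) i = S.lv F (S.lv G i) :=
  level_map hF _

theorem lv_congr {F G : T → T} {n i : ℕ} (h : Agree n F G) (hi : i < n) :
    S.lv F i = S.lv G i := by
  unfold lv
  rw [h]
  rwa [(S.exists_level i).choose_spec]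

theorem map_lt {F : T → T} (hF : F ∈ S.M) {a b : T} (h : a < b) : F a < F b := by
  obtain ⟨d, hd⟩ := Nat.exists_eq_add_of_lt (S.level_lt h)
  induction d generalizing b with
  | zero =>
    obtain ⟨x, p, c, hx⟩ := S.exists_succ_eq (b := b) (by omega)
    have hl := S.level_succ hx
    have hxb := (S.covBy_of_succ _ _ _ _ hx).le
    obtain rfl := S.eq_of_le_of_le h.le hxb (by omega)
    obtain ⟨b', hb', hle⟩ := (S.shape_preserving F hF).weakly_preserving _ _ _ _ hx
    exact (S.covBy_of_succ _ _ _ _ hb').lt.trans_le hle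
  | succ d ih =>
    obtain ⟨x, p, c, hx⟩ := S.exists_succ_eq (b := b) (by omega)
    have hl := S.level_succ hx
    have hxb := (S.covBy_of_succ _ _ _ _ hx).le
    obtain ⟨y, hy, hly⟩ := S.exists_le_level (b := x) (i := level a) (by omega)
    obtain rfl := S.eq_of_le_of_le h.le (hy.trans hxb) hly.symm
    have hax : a < x := lt_of_le_of_ne hy (by rintro rfl; omega)
    refine (ih hax (by omega)).trans ?_
    obtain ⟨b', hb', hle⟩ := (S.shape_preserving F hF).weakly_preserving _ _ _ _ hx
    exact (S.covBy_of_succ _ _ _ _ hb').lt.trans_le hle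

theorem map_le {F : T → T} (hF : F ∈ S.M) {a b : T} (h : a ≤ b) : F a ≤ F b := by
  rcases h.eq_or_lt with rfl | h
  · exact le_rfl
  · exact (map_lt hF h).le

theorem lv_strictMono {F : T → T} (hF : F ∈ S.M) : StrictMono (S.lv F) := by
  intro i j hij
  obtain ⟨b, hb⟩ := S.exists_level j
  obtain ⟨a, hab, ha⟩ := S.exists_le_level (b := b) (i := i) (by omega)
  have := S.level_lt (map_lt hF (lt_of_le_of_ne hab (by rintro rfl; omega)))
  rwa [level_map hF, level_map hF, ha, hb] at this

theorem le_lv {F : T → T} (hF : F ∈ S.M) (i : ℕ) : i ≤ S.lv F i := (lv_strictMono hF).le_apply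

theorem lv_add_le {F : T → T} (hF : F ∈ S.M) (i j : ℕ) : S.lv F i + j ≤ S.lv F (i + j) := by
  induction j with
  | zero => exact le_rfl
  | succ j ih =>
    have := lv_strictMono hF (show i + j < i + (j + 1) by omega)
    omega

theorem levelMap_iff {F : T → T} (hF : F ∈ S.M) {i j : ℕ} : LevelMap F i j ↔ S.lv F i = j := by
  constructor
  · rintro ⟨a, rfl, rfl⟩
    exact (level_map hF a).symm
  · rintro rfl
    exact ⟨_, (S.exists_level i).choose_spec, rfl⟩

theorem _root_.ShapeRamsey.SkipsOnly.lv_eq {F : T → T} (hF : F ∈ S.M) {m : ℕ} (h : SkipsOnly F m) (i : ℕ) :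
    S.lv F i = if i < m then i else i + 1 := by
  have hg : StrictMono (fun i : ℕ => if i < m then i else i + 1) := by
    intro a b hab
    simp only
    split_ifs <;> omega
  have : S.lv F = fun i : ℕ => if i < m then i else i + 1 := by
    refine (StrictMono.range_inj (lv_strictMono hF) hg).1 ?_
    have h1 : Set.range (S.lv F) = {m}ᶜ := by
      rw [← h]
      ext j
      simp [levelMap_iff hF]
    rw [h1]
    ext j
    simp only [Set.mem_compl_iff, Set.mem_singleton_iff, Set.mem_range]
    constructor
    · intro hj
      rcases lt_or_gt_of_ne hj with h | h
      · exact ⟨j, by simp [h]⟩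
      · exact ⟨j - 1, by rw [if_neg (by omega)]; omega⟩
    · rintro ⟨y, hy⟩
      split_ifs at hy <;> omega
  exact congrFun this i

theorem skips_of_gap {F : T → T} (hF : F ∈ S.M) {n j : ℕ} (h : j < S.lv F n)
    (h' : ∀ i < n, S.lv F i < j) : Skips F j := by
  intro i hi
  rw [levelMap_iff hF] at hi
  rcases lt_or_ge i n with hin | hin
  · have := h' i hin
    omega
  · have := (lv_strictMono hF).monotone hin
    omega

/-- A shape-preserving function is determined by the lower levels on a level without a gap. -/
theorem agree_succ {F G : T → T} (hF : F ∈ S.M) (hG : G ∈ S.M) {i : ℕ} (h : Agree (i + 1) F G)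
    (h1 : S.lv F (i + 1) = S.lv F i + 1) (h2 : S.lv G (i + 1) = S.lv F i + 1) :
    Agree (i + 2) F G := by
  intro b hb
  rcases Nat.lt_succ_iff_lt_or_eq.1 hb with hb | hb
  · exact h b hb
  obtain ⟨a, p, c, hs⟩ := S.exists_succ_eq (b := b) (by omega)
  have hl := S.level_succ hs
  obtain ⟨x, hx, hxF⟩ := (S.shape_preserving F hF).weakly_preserving _ _ _ _ hs
  obtain ⟨y, hy, hyG⟩ := (S.shape_preserving G hG).weakly_preserving _ _ _ _ hs
  have hp : p.map F = p.map G := by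
    refine List.map_congr_left (fun q hq => h q ?_)
    have := S.level_param_lt _ _ _ _ hs q hq
    omega
  have hai : level a = i := by omega
  rw [h a (by omega), hp, hy] at hx
  obtain rfl : y = x := by simpa using hx
  have hly := S.level_succ hy
  rw [level_map hG, hai] at hly
  have hh := lv_congr (S := S) h (Nat.lt_succ_self i)
  rw [← S.eq_of_le_of_level hxF (by rw [level_map hF, hb]; omega),
    ← S.eq_of_le_of_level hyG (by rw [level_map hG, hb]; omega)]

theorem agree_id {F : T → T} (hF : F ∈ S.M) {n : ℕ} (h : ∀ i < n, S.lv F i = i) :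
    Agree n F id := by
  induction n with
  | zero => intro a ha; omega
  | succ n ih =>
    cases n with
    | zero =>
      intro a ha
      have h0 := (S.shape_preserving F hF).root_preserving a a (by omega) le_rfl
      refine (S.eq_of_le_of_level h0 ?_).symm
      rw [level_map hF, h _ ha]
    | succ n =>
      refine agree_succ hF S.id_mem (ih (fun i hi => h i (by omega))) ?_ ?_
      · rw [h _ (by omega), h _ (by omega)]
      · rw [lv_id, h _ (by omega)]

theorem lv_of_mem_MFix {n i : ℕ} {F : T → T} (hF : F ∈ S.MFix n) (hi : i < n) :
    S.lv F i = i := by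
  rw [lv_congr (S := S) (show Agree n F id from hF.2) hi, lv_id]

theorem mem_MFix_of_lv {n : ℕ} {F : T → T} (hF : F ∈ S.M) (h : ∀ i < n, S.lv F i = i) :
    F ∈ S.MFix n :=
  ⟨hF, agree_id hF h⟩

theorem MFix_mono {m n : ℕ} (h : m ≤ n) {F : T → T} (hF : F ∈ S.MFix n) : F ∈ S.MFix m :=
  ⟨hF.1, fun a ha => hF.2 a (by omega)⟩

theorem id_mem_MFix (n : ℕ) : id ∈ S.MFix n := ⟨S.id_mem, fun _ _ => rfl⟩

theorem comp_mem_MFix {n : ℕ} {F G : T → T} (hF : F ∈ S.MFix n) (hG : G ∈ S.MFix n) :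
    F ∘ G ∈ S.MFix n :=
  ⟨S.comp_mem F hF.1 G hG.1, fun a ha => by simp [hG.2 a ha, hF.2 a ha]⟩

theorem mem_MFix_of_agree {n m : ℕ} (h : n ≤ m) {F G : T → T} (hF : F ∈ S.MFix n) (hG : G ∈ S.M)
    (hFG : Agree m F G) : G ∈ S.MFix n :=
  ⟨hG, fun a ha => by rw [← hFG a (by omega), hF.2 a ha]⟩

theorem agree_id_of_lv {n : ℕ} {F : T → T} (hF : F ∈ S.MFix n) (h : S.lv F n = n) :
    Agree (n + 1) F id := by
  refine agree_id hF.1 (fun i hi => ?_)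
  rcases Nat.lt_succ_iff_lt_or_eq.1 hi with hi | rfl
  · exact lv_of_mem_MFix hF hi
  · exact h

theorem _root_.ShapeRamsey.Agree.comp_right {n m : ℕ} {F G H : T → T} (hH : H ∈ S.M) (h : Agree m F G)
    (hm : ∀ i < n, S.lv H i < m) : Agree n (F ∘ H) (G ∘ H) :=
  fun a ha => h (H a) (by rw [level_map hH]; exact hm _ ha)

/-- If `x = S(a, p, c)`, then `a` and all entries of `p` lie below level `n` and are fixed, so shape
preservation reads `x ≤ F x`. -/
theorem le_map {n : ℕ} {F : T → T} (hF : F ∈ S.MFix n) {x : T} (hx : level x ≤ n) : x ≤ F x := by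
  rcases Nat.eq_zero_or_pos (level x) with h0 | h0
  · exact (S.shape_preserving F hF.1).root_preserving x x h0 le_rfl
  obtain ⟨a, p, c, hs⟩ := S.exists_succ_eq h0
  have hl := S.level_succ hs
  obtain ⟨y, hy, hyF⟩ := (S.shape_preserving F hF.1).weakly_preserving _ _ _ _ hs
  have hp : p.map F = p := by
    conv_rhs => rw [← List.map_id p]
    refine List.map_congr_left (fun q hq => hF.2 q ?_)
    have := S.level_param_lt _ _ _ _ hs q hq
    omega
  rw [hp, hF.2 a (by omega), hs] at hy
  obtain rfl : x = y := by simpa using hy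
  exact hyF

/-! ### Decomposition and factorisation from (M2). -/

/-- Splitting off the last skipped level. -/
theorem decomp_step {F : T → T} (hF : F ∈ S.M) {n j : ℕ} (h : S.lv F n = j + 1)
    (hs : Skips F j) : ∃ F₁ ∈ S.M, ∃ F₂ ∈ S.MFix j, (∀ i, S.lv F₂ (j + i) = j + 1 + i) ∧
      S.lv F₁ n = j ∧ Agree (n + 1) F (F₂ ∘ F₁) ∧ Agree n F F₁ := by
  obtain ⟨F₁, h1, F₂, h2, h2s, h12⟩ := S.decomposition n j F hF ((levelMap_iff hF).2 h) hs
  have hlv := SkipsOnly.lv_eq h2 h2s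
  have h2m : F₂ ∈ S.MFix j := mem_MFix_of_lv h2 (fun i hi => by rw [hlv, if_pos hi])
  have hag : Agree (n + 1) F (F₂ ∘ F₁) := fun a ha => (h12 a (by omega)).symm
  have h3 := lv_congr (S := S) hag (Nat.lt_succ_self n)
  rw [lv_comp h2, hlv, h] at h3
  have h4 : S.lv F₁ n = j := by
    split_ifs at h3 <;> omega
  refine ⟨F₁, h1, F₂, h2m, fun i => ?_, h4, hag, fun a ha => ?_⟩
  · rw [hlv, if_neg (by omega)]; omega
  · rw [hag a (by omega)]
    refine h2m.2 _ ?_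
    rw [level_map h1, ← h4]
    exact lv_strictMono h1 ha

/-- A member of `M` can be changed above level `n` so that it skips no level above the image of
level `n`. -/
theorem exists_tight {F : T → T} (hF : F ∈ S.M) (n : ℕ) :
    ∃ F' ∈ S.M, Agree (n + 1) F F' ∧ ∀ i, S.lv F' (n + i) = S.lv F n + i := by
  obtain ⟨j, hj⟩ : ∃ j, S.lv F n = j := ⟨_, rfl⟩
  induction j generalizing n F with
  | zero =>
    have hn := le_lv hF n
    obtain rfl : n = 0 := by omega
    refine ⟨id, S.id_mem, agree_id hF (fun i hi => ?_), fun i => ?_⟩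
    · obtain rfl : i = 0 := by omega
      exact hj
    · rw [lv_id, hj]
  | succ j ih =>
    by_cases hs : Skips F j
    · obtain ⟨F₁, h1, F₂, h2, h2s, h1n, hag, -⟩ := decomp_step hF hj hs
      obtain ⟨F', hF', hag', hlv⟩ := ih h1 n h1n
      refine ⟨F₂ ∘ F', S.comp_mem _ h2.1 _ hF', hag.trans (hag'.comp_left F₂), fun i => ?_⟩
      rw [lv_comp h2.1, hlv, h1n, h2s, hj]
    -- Here `j` must be the image of level `n - 1`: there is no gap, so a tight function agreeing
    -- with `F` up to level `n - 1` also agrees on level `n`.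
    · obtain ⟨i, hi⟩ : ∃ i, S.lv F i = j := by
        unfold Skips at hs
        push Not at hs
        obtain ⟨i, hi⟩ := hs
        exact ⟨i, (levelMap_iff hF).1 hi⟩
      have hin : i < n := (lv_strictMono hF).lt_iff_lt.1 (by omega)
      obtain ⟨d, rfl⟩ := Nat.exists_eq_add_of_lt hin
      have : S.lv F i + (d + 1) ≤ S.lv F (i + d + 1) := lv_add_le hF i (d + 1)
      obtain rfl : d = 0 := by omega
      obtain ⟨F', hF', hag, hlv⟩ := ih hF i hi
      refine ⟨F', hF', agree_succ hF hF' hag ?_ (hlv 1), fun t => ?_⟩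
      · simp only [add_zero] at hj ⊢
        omega
      · have := hlv (1 + t)
        rw [add_zero, add_assoc, this]
        simp only [add_zero] at hj
        omega

theorem exists_tight_MFix {n m : ℕ} (hnm : n ≤ m + 1) {F : T → T} (hF : F ∈ S.MFix n) :
    ∃ F' ∈ S.MFix n, Agree (m + 1) F F' ∧ ∀ i, S.lv F' (m + i) = S.lv F m + i := by
  obtain ⟨F', h1, h2, h3⟩ := exists_tight hF.1 m
  exact ⟨F', mem_MFix_of_agree hnm hF h1 h2, h2, h3⟩

/-- Splitting off all the levels from `p` on that are skipped just below the image of level `n`. -/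
theorem exists_decomp {F : T → T} (hF : F ∈ S.M) {n p : ℕ} (hp : p ≤ S.lv F n)
    (h : ∀ i < n, S.lv F i < p) : ∃ G ∈ S.MFix p, ∃ F' ∈ S.M,
      (∀ i, S.lv G (p + i) = S.lv F n + i) ∧ S.lv F' n = p ∧ Agree (n + 1) F (G ∘ F') ∧
      Agree n F F' := by
  obtain ⟨d, hd⟩ := Nat.exists_eq_add_of_le hp
  induction d generalizing F with
  | zero =>
    exact ⟨id, id_mem_MFix p, F, hF, fun i => by rw [lv_id, hd]; omega, by omega,
      fun _ _ => rfl, fun _ _ => rfl⟩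
  | succ d ih =>
    have hs : Skips F (p + d) := skips_of_gap hF (n := n) (by omega)
      (fun i hi => by have := h i hi; omega)
    obtain ⟨F₁, h1, F₂, h2, h2s, h1n, hag, hag'⟩ := decomp_step (j := p + d) hF hd hs
    obtain ⟨G, hG, F', hF', hlv, hn, ha, ha'⟩ := ih h1 (by omega)
      (fun i hi => by rw [← lv_congr hag' hi]; exact h i hi) h1n
    refine ⟨F₂ ∘ G, comp_mem_MFix (MFix_mono (by omega) h2) hG, F', hF', fun i => ?_, hn,
      hag.trans (ha.comp_left F₂), hag'.trans ha'⟩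
    rw [lv_comp h2.1, hlv, h1n, h2s, hd]
    omega

/-- Factoring through a function that skips no level above the image of level `n`. -/
theorem exists_factor {F E : T → T} (hF : F ∈ S.M) (hE : E ∈ S.M) {n : ℕ} (h : Agree (n + 1) F E)
    (hlv : ∀ i, S.lv E (n + i) = S.lv F n + i) (K : ℕ) :
    ∃ H ∈ S.MFix (S.lv F n + 1), Agree (n + K + 1) F (H ∘ E) := by
  induction K with
  | zero => exact ⟨id, id_mem_MFix _, h⟩
  | succ K ih =>
    obtain ⟨H₀, hH₀, hag₀⟩ := ih
    obtain ⟨H, hH, hHH, hHlv⟩ := exists_tight_MFix (m := S.lv F n + K) (by omega) hH₀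
    have hag : Agree (n + K + 1) F (H ∘ E) := by
      refine hag₀.trans (Agree.comp_right hE hHH (fun i hi => ?_))
      have := (lv_strictMono hE).monotone (Nat.le_of_lt_succ hi)
      rw [hlv] at this
      omega
    have e1 : S.lv F (n + K) = S.lv H (S.lv F n + K) := by
      rw [lv_congr (S := S) hag (Nat.lt_succ_self _), lv_comp hH.1, hlv]
    have e2 : S.lv (H ∘ E) (n + K + 1) = S.lv F (n + K) + 1 := by
      rw [lv_comp hH.1, add_assoc, hlv, ← add_assoc, hHlv, e1]
      have := hHlv 0
      simp only [add_zero] at this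
      omega
    -- Removing the gap of `F` just below the image of level `n + K + 1` leaves an `F'` forced to
    -- agree with `H ∘ E` there; the gap is restored by `G`.
    obtain ⟨G, hG, F', hF', -, hn, ha, ha'⟩ := exists_decomp hF (n := n + K + 1)
      (p := S.lv F (n + K) + 1) (lv_strictMono hF (Nat.lt_succ_self _))
      (fun i hi => Nat.lt_succ_of_le ((lv_strictMono hF).monotone (Nat.le_of_lt_succ hi)))
    have hF'F : S.lv F' (n + K) = S.lv F (n + K) :=
      (lv_congr (S := S) ha' (Nat.lt_succ_self _)).symm
    have hFE : Agree (n + K + 2) F' (H ∘ E) :=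
      agree_succ hF' (S.comp_mem _ hH.1 _ hE) (ha'.symm.trans hag) (by rw [hn, hF'F])
        (by rw [e2, hF'F])
    refine ⟨G ∘ H, comp_mem_MFix (MFix_mono ?_ hG) hH, ha.trans (hFE.comp_left G)⟩
    have := (lv_strictMono hF).monotone (Nat.le_add_right n K)
    omega

/-- Finitely many representatives of the members of `M^n` that map level `n` to level `j`. -/
theorem exists_reps (S : SMTree T A) (n j : ℕ) : ∃ (q : ℕ) (e : Fin q → T → T),
    (∀ i, e i ∈ S.MFix n ∧ ∀ t, S.lv (e i) (n + t) = j + t) ∧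
    ∀ f ∈ S.MFix n, S.lv f n = j → ∃ i, Agree (n + 1) f (e i) := by
  let X := {a : T // level a < n + 1}
  let Y := {a : T // level a < j + 1}
  have : Finite X := S.finite_level_lt (n + 1)
  have : Finite Y := S.finite_level_lt (j + 1)
  let R : Set (X → Y) := {u | ∃ f ∈ S.MFix n, S.lv f n = j ∧ ∀ x : X, f x = u x}
  obtain ⟨q, ⟨φ⟩⟩ := Finite.exists_equiv_fin R
  have key : ∀ i : Fin q, ∃ f ∈ S.MFix n, (∀ t, S.lv f (n + t) = j + t) ∧
      ∀ x : X, f x = (φ.symm i).1 x := by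
    intro i
    obtain ⟨f, hf, hj, hx⟩ := (φ.symm i).2
    obtain ⟨f', hf', hag, hlv⟩ := exists_tight_MFix (m := n) (by omega) hf
    exact ⟨f', hf', fun t => by rw [hlv, hj], fun x => by rw [← hag _ x.2, hx]⟩
  choose e he hlv hx using key
  refine ⟨q, e, fun i => ⟨he i, hlv i⟩, fun f hf hj => ?_⟩
  have hb : ∀ x : X, level (f x) < j + 1 := by
    intro x
    rw [level_map hf.1, ← hj]
    exact Nat.lt_succ_of_le ((lv_strictMono hf.1).monotone (Nat.le_of_lt_succ x.2))
  let u : R := ⟨fun x => ⟨f x, hb x⟩, f, hf, hj, fun x => rfl⟩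
  refine ⟨φ u, fun a ha => ?_⟩
  rw [hx (φ u) ⟨a, ha⟩, φ.symm_apply_apply]

/-! ### Letters and their duplication by (M3). -/

variable (S)

/-- The letter by which `e` extends a node `a` of level `n` occurs at level `v` below `F a`. -/
def HasLetter (n : ℕ) (e : T → T) (v : ℕ) (F : T → T) : Prop :=
  ∀ a p c, level a = n → S.succ a p c = some (e a) →
    ∃ b t, level b = v ∧ S.succ b p c = some t ∧ t ≤ F a

/-- On level `n`, the values of `F'` extend the values of `F` by the letters of `e`. -/
def Appends (n : ℕ) (e F F' : T → T) : Prop :=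
  ∀ a p c, level a = n → S.succ a p c = some (e a) → S.succ (F a) p c = some (F' a)

/-- A function duplicating level `v` at level `m`. -/
noncomputable def dup (v m : ℕ) : T → T :=
  if h : v < m then (S.duplication v m h).choose else id

variable {S}

theorem dup_mem {v m : ℕ} (h : v < m) : S.dup v m ∈ S.M := by
  rw [dup, dif_pos h]
  exact (S.duplication v m h).choose_spec.1

theorem lv_dup {v m : ℕ} (h : v < m) (i : ℕ) :
    S.lv (S.dup v m) i = if i < m then i else i + 1 := by
  refine SkipsOnly.lv_eq (dup_mem h) ?_ i
  rw [dup, dif_pos h]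
  exact (S.duplication v m h).choose_spec.2.1

theorem dup_mem_MFix {v m : ℕ} (h : v < m) : S.dup v m ∈ S.MFix m :=
  mem_MFix_of_lv (dup_mem h) (fun i hi => by rw [lv_dup h, if_pos hi])

theorem lv_dup_add {v m : ℕ} (h : v < m) (i : ℕ) : S.lv (S.dup v m) (m + i) = m + i + 1 := by
  rw [lv_dup h, if_neg (by omega)]

theorem succ_dup {v m : ℕ} (h : v < m) {a b : T} (ha : level a = v) (hb : level b = m)
    {p : List T} {c : A} {s : T} (hs : S.succ a p c = some s) (hsb : s ≤ b) :
    S.succ b p c = some (S.dup v m b) := by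
  rw [dup, dif_pos h]
  exact (S.duplication v m h).choose_spec.2.2 a b ha hb p c s hs hsb

theorem exists_letter {n : ℕ} {e : T → T} (he : e ∈ S.MFix n) (hn : S.lv e n = n + 1) {a : T}
    (ha : level a = n) : ∃ p c, S.succ a p c = some (e a) := by
  have hl : level (e a) = n + 1 := by rw [level_map he.1, ha, hn]
  obtain ⟨a', p, c, hs⟩ := S.exists_succ_eq (b := e a) (by omega)
  have hl' := S.level_succ hs
  obtain rfl := S.eq_of_le_of_le (le_map he ha.le) (S.covBy_of_succ _ _ _ _ hs).le (by omega)
  exact ⟨p, c, hs⟩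

theorem Appends.unique {n : ℕ} {e F G F' G' : T → T} (he : e ∈ S.MFix n)
    (hn : S.lv e n = n + 1) (h : S.Appends n e F F') (h' : S.Appends n e G G') {a : T}
    (ha : level a = n) (hFG : F a = G a) : F' a = G' a := by
  obtain ⟨p, c, hs⟩ := exists_letter he hn ha
  have h1 := h a p c ha hs
  have h2 := h' a p c ha hs
  rw [hFG, h2] at h1
  exact (Option.some.inj h1).symm

theorem Appends.hasLetter {n m : ℕ} {e F F' : T → T} (hF : ∀ a, level a = n → level (F a) = m)
    (h : S.Appends n e F F') : S.HasLetter n e m F' :=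
  fun a p c ha hs => ⟨F a, F' a, hF a ha, h a p c ha hs, le_rfl⟩

theorem HasLetter.mono {n v : ℕ} {e F F' : T → T} (h : S.HasLetter n e v F)
    (hF : ∀ a, level a = n → F a ≤ F' a) : S.HasLetter n e v F' := by
  intro a p c ha hs
  obtain ⟨b, t, hb, ht, hle⟩ := h a p c ha hs
  exact ⟨b, t, hb, ht, hle.trans (hF a ha)⟩

theorem HasLetter.appends_dup {n v m : ℕ} {e F : T → T} (h : S.HasLetter n e v F) (hvm : v < m)
    (hF : ∀ a, level a = n → level (F a) = m) : S.Appends n e F (S.dup v m ∘ F) := by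
  intro a p c ha hs
  obtain ⟨b, t, hb, ht, hle⟩ := h a p c ha hs
  exact succ_dup hvm hb (hF a ha) ht hle

/-- The parameters of the letter lie below level `n` and are fixed by `F`; since `F` leaves no gap
between levels `n` and `n + 1`, the inequality in shape preservation is an equality. -/
theorem appends_comp {n : ℕ} {e F : T → T} (he : e ∈ S.MFix n) (hF : F ∈ S.MFix n)
    (hn : S.lv e n = n + 1) (hFn : S.lv F (n + 1) = S.lv F n + 1) :
    S.Appends n e F (F ∘ e) := by
  intro a p c ha hs
  obtain ⟨y, hy, hyF⟩ := (S.shape_preserving F hF.1).weakly_preserving _ _ _ _ hs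
  have hp : p.map F = p := by
    conv_rhs => rw [← List.map_id p]
    refine List.map_congr_left (fun q hq => hF.2 q ?_)
    have := S.level_param_lt _ _ _ _ hs q hq
    omega
  rw [hp] at hy
  have hly := S.level_succ hy
  rw [level_map hF.1, ha] at hly
  have : level (F (e a)) = S.lv F (n + 1) := by rw [level_map hF.1, level_map he.1, ha, hn]
  rw [hy, S.eq_of_le_of_level hyF (by omega), Function.comp_apply]

/-- There is a function containing all letters of a given finite family. -/
theorem exists_base {n : ℕ} (es : List (T → T))
    (hes : ∀ e ∈ es, e ∈ S.MFix n ∧ S.lv e n = n + 1) :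
    ∃ B ∈ S.MFix n, (∀ i, S.lv B (n + i) = S.lv B n + i) ∧
      ∀ e ∈ es, ∃ v < S.lv B n, S.HasLetter n e v B := by
  induction es with
  | nil => exact ⟨id, id_mem_MFix n, fun i => by simp [lv_id], by simp⟩
  | cons e es ih =>
    obtain ⟨B, hB, hlv, hlet⟩ := ih (fun x hx => hes x (List.mem_cons_of_mem _ hx))
    obtain ⟨he, hen⟩ := hes e List.mem_cons_self
    -- Composing with `e` places its letter at level `lv B n`; letters already present survive
    -- because values only grow upwards.
    have hBe := comp_mem_MFix hB he
    obtain ⟨B', hB', hag, hlv'⟩ := exists_tight_MFix (m := n) (by omega) hBe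
    have h0 : S.lv B' n = S.lv B n + 1 := by
      rw [← lv_congr hag (Nat.lt_succ_self n), lv_comp hB.1, hen, hlv]
    have hap : S.Appends n e B B' := by
      intro a p c ha hs
      rw [← hag a (by omega)]
      exact appends_comp he hB hen (hlv 1) a p c ha hs
    refine ⟨B', hB', fun i => by rw [hlv', lv_congr hag (Nat.lt_succ_self n)], ?_⟩
    intro x hx
    rcases List.mem_cons.1 hx with rfl | hx
    · refine ⟨S.lv B n, by omega, hap.hasLetter (fun a ha => ?_)⟩
      rw [level_map hB.1, ha]
    · obtain ⟨v, hv, hl⟩ := hlet x hx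
      refine ⟨v, by omega, hl.mono (fun a ha => ?_)⟩
      obtain ⟨p, c, hs⟩ := exists_letter he hen ha
      exact (S.covBy_of_succ _ _ _ _ (hap a p c ha hs)).le

/-! ### Words and variable words as functions. -/

/-- The function obtained from `B` by appending the letters of a word, read from right to left;
the letter `x` is copied from level `pos x`. -/
noncomputable def wordMap (S : SMTree T A) {α : Type*} (B : T → T) (Q : ℕ) (pos : α → ℕ) :
    List α → T → T
  | [] => B
  | x :: w => S.dup (pos x) (Q + w.length) ∘ wordMap S B Q pos w

section wordMap

variable {α : Type*} {n : ℕ} {B : T → T} {pos : α → ℕ} {e : α → T → T}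

theorem wordMap_mem (hB : B ∈ S.MFix n) (hpos : ∀ x, pos x < S.lv B n) (w : List α) :
    S.wordMap B (S.lv B n) pos w ∈ S.MFix n := by
  induction w with
  | nil => exact hB
  | cons x w ih =>
    have h1 := hpos x
    have h2 := le_lv hB.1 n
    exact comp_mem_MFix (MFix_mono (by omega) (dup_mem_MFix (by omega))) ih

theorem lv_wordMap (hlv : ∀ i, S.lv B (n + i) = S.lv B n + i)
    (hpos : ∀ x, pos x < S.lv B n) (w : List α) (i : ℕ) :
    S.lv (S.wordMap B (S.lv B n) pos w) (n + i) = S.lv B n + w.length + i := by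
  induction w with
  | nil => simpa [wordMap] using hlv i
  | cons x w ih =>
    have h1 := hpos x
    rw [wordMap, lv_comp (dup_mem (by omega)), ih, lv_dup_add (by omega), List.length_cons]
    omega

/-- Each duplication moves values upwards in the tree, so the occurrences of letters in `B` persist.
-/
theorem wordMap_hasLetter (hB : B ∈ S.MFix n) (hlv : ∀ i, S.lv B (n + i) = S.lv B n + i)
    (hpos : ∀ x, pos x < S.lv B n) (hlet : ∀ x, S.HasLetter n (e x) (pos x) B) (w : List α)
    (y : α) : S.HasLetter n (e y) (pos y) (S.wordMap B (S.lv B n) pos w) := by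
  induction w with
  | nil => exact hlet y
  | cons x w ih =>
    refine ih.mono (fun a ha => ?_)
    have h1 := hpos x
    refine le_map (dup_mem_MFix (by omega)) ?_
    rw [level_map (wordMap_mem hB hpos w).1, ha]
    exact (lv_wordMap hlv hpos w 0).le

theorem wordMap_appends (hB : B ∈ S.MFix n) (hlv : ∀ i, S.lv B (n + i) = S.lv B n + i)
    (hpos : ∀ x, pos x < S.lv B n) (hlet : ∀ x, S.HasLetter n (e x) (pos x) B) (w : List α)
    (y : α) : S.Appends n (e y) (S.wordMap B (S.lv B n) pos w)
      (S.wordMap B (S.lv B n) pos (y :: w)) := by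
  have h1 := hpos y
  refine (wordMap_hasLetter hB hlv hpos hlet w y).appends_dup (by omega) (fun a ha => ?_)
  rw [level_map (wordMap_mem hB hpos w).1, ha]
  exact lv_wordMap hlv hpos w 0

/-- A variable word is realised by a function on `T(≤n+1)`. -/
theorem exists_lineMap (hB : B ∈ S.MFix n) (hlv : ∀ i, S.lv B (n + i) = S.lv B n + i)
    (hpos : ∀ x, pos x < S.lv B n) (hlet : ∀ x, S.HasLetter n (e x) (pos x) B)
    (he : ∀ x, e x ∈ S.MFix n) (hen : ∀ x, S.lv (e x) n = n + 1) (w : List (Option α))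
    (hw : none ∈ w) : ∃ F ∈ S.MFix n, S.lv F (n + 1) = S.lv B n + w.length ∧
      (∀ x, Agree (n + 1) (F ∘ e x) (S.wordMap B (S.lv B n) pos (w.map (·.getD x)))) ∧
      ∃ v < S.lv B n + w.length, ∀ x, S.HasLetter n (e x) v (F ∘ e x) := by
  induction w with
  | nil => simp at hw
  | cons y w ih =>
    have hnB := le_lv hB.1 n
    by_cases hw' : none ∈ w
    · obtain ⟨F, hF, hFl, hag, v, hv, hvl⟩ := ih hw'
      have hle : ∀ x a, level a = n → level ((F ∘ e x) a) = S.lv B n + w.length := by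
        intro x a ha
        rw [Function.comp_apply, level_map hF.1, level_map (he x).1, ha, hen, hFl]
      -- A constant letter is copied from its place in `B`. A further variable is copied from level
      -- `v`, where `F ∘ e x` carries the letter of `e x` for every `x` at once.
      obtain ⟨z, hz, happ⟩ : ∃ z < S.lv B n + w.length, ∀ x,
          S.Appends n (e (y.getD x)) (F ∘ e x) (S.dup z (S.lv B n + w.length) ∘ (F ∘ e x)) := by
        cases y with
        | none => exact ⟨v, hv, fun x => (hvl x).appends_dup hv (hle x)⟩
        | some y =>
          have h1 := hpos y
          refine ⟨pos y, by omega, fun x => ?_⟩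
          have h2 : S.HasLetter n (e y) (pos y) (F ∘ e x) :=
            (wordMap_hasLetter hB hlv hpos hlet _ y).mono
              (fun a ha => (hag x a (by omega)).ge)
          exact h2.appends_dup (by omega) (hle x)
      have hD := dup_mem_MFix (S := S) hz
      have hF' : S.dup z (S.lv B n + w.length) ∘ F ∈ S.MFix n :=
        comp_mem_MFix (MFix_mono (by omega) hD) hF
      refine ⟨S.dup z (S.lv B n + w.length) ∘ F, hF', ?_, fun x a ha => ?_, v, ?_, fun x => ?_⟩
      · rw [lv_comp hD.1, hFl]
        exact lv_dup_add hz 0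
      · rcases Nat.lt_succ_iff_lt_or_eq.1 ha with ha | ha
        · rw [(comp_mem_MFix hF' (he x)).2 a ha, (wordMap_mem hB hpos _).2 a ha]
        · exact (happ x).unique (he _) (hen _) (wordMap_appends hB hlv hpos hlet _ (y.getD x)) ha
            (hag x a (by omega))
      · simp only [List.length_cons]
        omega
      · refine (hvl x).mono (fun a ha => ?_)
        exact le_map hD (hle x a ha).le
    -- This is the variable appended first. No duplication is needed: the function of the constant
    -- word `w`, composed with `e x`, appends the letter of `e x` itself.
    · obtain ⟨w, rfl⟩ : ∃ w' : List α, w = w'.map some := by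
        clear ih hw
        induction w with
        | nil => exact ⟨[], rfl⟩
        | cons y w ih =>
          simp only [List.mem_cons, not_or] at hw'
          obtain ⟨w', rfl⟩ := ih hw'.2
          cases y with
          | none => exact absurd rfl hw'.1
          | some y => exact ⟨y :: w', rfl⟩
      obtain rfl : y = none := by simpa [eq_comm] using hw
      have hF := wordMap_mem hB hpos w
      have hFlv := lv_wordMap hlv hpos w
      have h0 := hFlv 0
      simp only [add_zero] at h0
      have happ : ∀ x, S.Appends n (e x) (S.wordMap B (S.lv B n) pos w)
          (S.wordMap B (S.lv B n) pos w ∘ e x) := fun x =>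
        appends_comp (he x) hF (hen x) (by rw [hFlv, h0])
      refine ⟨_, hF, ?_, fun x a ha => ?_, S.lv B n + w.length, ?_, fun x => ?_⟩
      · rw [hFlv]
        simp [add_assoc]
      · have hmap : (none :: w.map some).map (·.getD x) = x :: w := by
          simp
        rw [hmap]
        rcases Nat.lt_succ_iff_lt_or_eq.1 ha with ha | ha
        · rw [(comp_mem_MFix hF (he x)).2 a ha, (wordMap_mem hB hpos _).2 a ha]
        · exact (happ x).unique (he _) (hen _) (wordMap_appends hB hlv hpos hlet _ x) ha rfl
      · simp
      · refine (happ x).hasLetter (fun a ha => ?_)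
        rw [level_map hF.1, ha, h0]

end wordMap

/-! ### One-dimensional pigeonhole principles. -/

/-- The one-dimensional pigeonhole principle for one additional level, from the Hales-Jewett
theorem. -/
theorem exists_mono_succ (S : SMTree T A) (n : ℕ) (κ : Type) [Finite κ] : ∃ N : ℕ,
    ∀ χ : (T → T) → κ, (∀ F G, Agree (n + 1) F G → χ F = χ G) →
      ∃ F ∈ S.MFix n, S.lv F (n + 1) = N ∧
        ∃ c, ∀ g ∈ S.MFix n, S.lv g n = n + 1 → χ (F ∘ g) = c := by
  obtain ⟨q, e, he, hrep⟩ := S.exists_reps n (n + 1)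
  have hen : ∀ x, S.lv (e x) n = n + 1 := fun x => (he x).2 0
  obtain ⟨B, hB, hlv, hpos⟩ := exists_base (S := S) (n := n) (List.ofFn e) (by
    intro f hf
    obtain ⟨x, rfl⟩ := (List.mem_ofFn' e f).1 hf
    exact ⟨(he x).1, hen x⟩)
  have hpos : ∀ x, ∃ v < S.lv B n, S.HasLetter n (e x) v B :=
    fun x => hpos _ ((List.mem_ofFn' e _).2 ⟨x, rfl⟩)
  choose pos hpos hlet using hpos
  obtain ⟨ι, hι, hHJ⟩ := Combinatorics.Line.exists_mono_in_high_dimension (Fin q) κ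
  let φ := Fintype.equivFin ι
  refine ⟨S.lv B n + Fintype.card ι, fun χ hχ => ?_⟩
  obtain ⟨l, c, hl⟩ := hHJ (fun w => χ (S.wordMap B (S.lv B n) pos (List.ofFn (w ∘ φ.symm))))
  obtain ⟨F, hF, hFl, hag, -⟩ := exists_lineMap hB hlv hpos hlet (fun x => (he x).1) hen
    (List.ofFn (l.idxFun ∘ φ.symm)) (by
      obtain ⟨i, hi⟩ := l.proper
      exact (List.mem_ofFn' _ _).2 ⟨φ i, by simp [hi]⟩)
  refine ⟨F, hF, by simpa using hFl, c, fun g hg hgn => ?_⟩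
  obtain ⟨x, hx⟩ := hrep g hg hgn
  rw [← hl x, hχ _ _ ((hx.comp_left F).trans (hag x)), List.map_ofFn]
  rfl

/-- The one-dimensional pigeonhole principle on one level. -/
theorem exists_mono_add (S : SMTree T A) (m : ℕ) : ∀ (n : ℕ) (κ : Type) [Finite κ], ∃ N : ℕ,
    ∀ χ : (T → T) → κ, (∀ F G, Agree (n + 1) F G → χ F = χ G) →
      ∃ F ∈ S.MFix n, S.lv F (n + m) = N ∧
        ∃ c, ∀ g ∈ S.MFix n, S.lv g n = n + m → χ (F ∘ g) = c := by
  induction m with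
  | zero =>
    intro n κ _
    refine ⟨n, fun χ hχ => ⟨id, id_mem_MFix n, lv_id _, χ id, fun g hg hgn => ?_⟩⟩
    exact hχ _ _ (agree_id_of_lv hg hgn)
  | succ m ih =>
    intro n κ _
    obtain ⟨N₀, h₀⟩ := exists_mono_succ S n κ
    obtain ⟨q, e, he, hrep⟩ := S.exists_reps n N₀
    obtain ⟨N, hN⟩ := ih N₀ (Fin q → κ)
    refine ⟨N, fun χ hχ => ?_⟩
    obtain ⟨H, hH, hHl, c₀, hc₀⟩ := hN (fun h x => χ (h ∘ e x)) (by
      intro F G hFG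
      funext x
      refine hχ _ _ (hFG.comp_right (he x).1.1 (fun i hi => ?_))
      have h1 := (he x).2 0
      have h2 := (lv_strictMono (he x).1.1).monotone (Nat.le_of_lt_succ hi)
      simp only [add_zero] at h1
      omega)
    -- `H` makes the colour of `H ∘ G ∘ e x` independent of `G`, so one fixed representative `D` can
    -- replace every `G`. If there is no such `G`, the value `id` is never used.
    obtain ⟨D, hD⟩ : ∃ D, ∀ G ∈ S.MFix N₀, S.lv G N₀ = N₀ + m →
        D ∈ S.MFix N₀ ∧ S.lv D N₀ = N₀ + m := by
      by_cases h : ∃ D ∈ S.MFix N₀, S.lv D N₀ = N₀ + m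
      · obtain ⟨D, hD⟩ := h
        exact ⟨D, fun _ _ _ => hD⟩
      · exact ⟨id, fun G hG hGn => absurd ⟨G, hG, hGn⟩ h⟩
    obtain ⟨F₀, hF₀, hF₀l, c, hc⟩ := h₀ (fun f => χ (H ∘ D ∘ f))
      (fun F G hFG => hχ _ _ ((hFG.comp_left D).comp_left H))
    have hN₀ : n + 1 ≤ N₀ := hF₀l ▸ le_lv hF₀.1 (n + 1)
    obtain ⟨F₁, hF₁, hag₁, hlv₁⟩ := exists_tight_MFix (m := n + 1) (by omega) hF₀
    rw [hF₀l] at hlv₁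
    have hHn : H ∈ S.MFix n := MFix_mono (by omega) hH
    refine ⟨H ∘ F₁, comp_mem_MFix hHn hF₁, ?_, c, fun g hg hgn => ?_⟩
    · rw [lv_comp hH.1, show n + (m + 1) = n + 1 + m by omega, hlv₁, hHl]
    -- Aim: `F₁ ∘ g = F₁ ∘ G ∘ f = G' ∘ F₁ ∘ f` on `T(≤ n)`, where `f` sends level `n` to `n + 1`
    -- and `G'` fixes `T(< N₀)`. Then `G'` may be replaced by `D`.
    obtain ⟨G, hG, f, hf, hGlv, hfn, hag, hag'⟩ := exists_decomp hg.1 (n := n) (p := n + 1)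
      (by omega) (fun i hi => by rw [lv_of_mem_MFix hg hi]; omega)
    have hfm : f ∈ S.MFix n := mem_MFix_of_agree le_rfl hg hf hag'
    have hF₁m : F₁ ∘ G ∈ S.M := S.comp_mem _ hF₁.1 _ hG.1
    have hlow : ∀ i < n + 1, S.lv (F₁ ∘ G) i < N₀ := by
      intro i hi
      rw [lv_comp hF₁.1, lv_of_mem_MFix hG hi]
      have := lv_strictMono hF₁.1 hi
      have h1 := hlv₁ 0
      simp only [add_zero] at h1
      omega
    have hGn := hGlv 0
    simp only [add_zero, hgn] at hGn
    have hFG : S.lv (F₁ ∘ G) (n + 1) = N₀ + m := by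
      rw [lv_comp hF₁.1, hGn, show n + (m + 1) = n + 1 + m by omega, hlv₁]
    obtain ⟨G', hG', F', hF', hG'lv, hF'n, hag₂, hag₂'⟩ := exists_decomp hF₁m (n := n + 1)
      (p := N₀) (by omega) hlow
    have hFF' : Agree (n + 1) F₁ F' := by
      refine Agree.trans (fun a ha => ?_) hag₂'
      rw [Function.comp_apply, hG.2 a ha]
    -- On level `n + 1`, both values have level `N₀` and lie below the common node `F₁ (G b) = G'
    -- (F' b)`.
    have hFF : Agree (n + 2) F₁ F' := by
      intro b hb
      rcases Nat.lt_succ_iff_lt_or_eq.1 hb with hb' | hb'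
      · exact hFF' b hb'
      have h0 : S.lv F₁ (n + 1) = N₀ := hlv₁ 0
      have h1 : F₁ b ≤ F₁ (G b) := map_le hF₁.1 (le_map hG hb'.le)
      have h2 : F' b ≤ G' (F' b) := le_map hG' (by rw [level_map hF', hb', hF'n])
      have h3 : F₁ (G b) = G' (F' b) := hag₂ b hb
      refine S.eq_of_le_of_le h1 (h3 ▸ h2) ?_
      rw [level_map hF₁.1, level_map hF', hb', h0, hF'n]
    have hfb : ∀ i < n + 1, S.lv f i < n + 2 := by
      intro i hi
      have := (lv_strictMono hf).monotone (Nat.le_of_lt_succ hi)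
      omega
    have hfin : Agree (n + 1) (F₁ ∘ g) (G' ∘ (F₁ ∘ f)) :=
      (hag.comp_left F₁).trans ((hag₂.comp_right hf hfb).trans
        ((hFF.symm.comp_right hf hfb).comp_left G'))
    have hF₁f : F₁ ∘ f ∈ S.MFix n := comp_mem_MFix hF₁ hfm
    have hF₁fn : S.lv (F₁ ∘ f) n = N₀ := by
      rw [lv_comp hF₁.1, hfn]
      exact hlv₁ 0
    obtain ⟨x, hx⟩ := hrep _ hF₁f hF₁fn
    have hG'n : S.lv G' N₀ = N₀ + m := by rw [← hFG]; exact hG'lv 0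
    have key : ∀ G ∈ S.MFix N₀, S.lv G N₀ = N₀ + m → χ (H ∘ G ∘ (F₁ ∘ f)) = c₀ x := by
      intro G hG hGn
      rw [← hc₀ G hG hGn]
      exact hχ _ _ ((hx.comp_left G).comp_left H)
    obtain ⟨hDm, hDn⟩ := hD G' hG' hG'n
    calc χ ((H ∘ F₁) ∘ g) = χ (H ∘ G' ∘ (F₁ ∘ f)) := hχ _ _ (hfin.comp_left H)
      _ = χ (H ∘ D ∘ (F₁ ∘ f)) := by rw [key _ hG' hG'n, key _ hDm hDn]
      _ = χ (H ∘ D ∘ (F₀ ∘ f)) :=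
        hχ _ _ (((hag₁.symm.comp_right hf hfb).comp_left D).comp_left H)
      _ = c := hc f hfm hfn

theorem exists_mono_level (S : SMTree T A) (n M : ℕ) (κ : Type) [Finite κ] : ∃ N : ℕ,
    ∀ χ : (T → T) → κ, (∀ F G, Agree (n + 1) F G → χ F = χ G) →
      ∃ F ∈ S.MFix n, S.lv F M = N ∧
        ∃ c, ∀ g ∈ S.MFix n, S.lv g n = M → χ (F ∘ g) = c := by
  rcases lt_or_ge M n with h | h
  · refine ⟨M, fun χ _ => ⟨id, id_mem_MFix n, lv_id _, χ id, fun g hg hgn => ?_⟩⟩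
    have := le_lv hg.1 n
    omega
  · obtain ⟨m, rfl⟩ := Nat.exists_eq_add_of_le h
    exact S.exists_mono_add m n κ

/-- The one-dimensional pigeonhole principle on finitely many levels, with one colour for each. -/
theorem exists_mono_each_level (S : SMTree T A) (n M : ℕ) (κ : Type) [Finite κ] : ∃ N : ℕ,
    ∀ χ : (T → T) → κ, (∀ F G, Agree (n + 1) F G → χ F = χ G) →
      ∃ F ∈ S.MFix n, S.lv F M = N ∧
        ∃ c : ℕ → κ, ∀ i ≤ M, ∀ g ∈ S.MFix n, S.lv g n = i → χ (F ∘ g) = c i := by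
  induction M with
  | zero =>
    refine ⟨0, fun χ hχ => ⟨id, id_mem_MFix n, lv_id _, fun _ => χ id, fun i hi g hg hgn => ?_⟩⟩
    have h := le_lv hg.1 n
    have h' : S.lv g n = n := by omega
    exact hχ _ _ (agree_id_of_lv hg h')
  | succ M ih =>
    obtain ⟨N₁, h₁⟩ := ih
    obtain ⟨N, hN⟩ := S.exists_mono_level n (N₁ + 1) κ
    refine ⟨N, fun χ hχ => ?_⟩
    obtain ⟨F₁, hF₁, hF₁l, c₁, hc₁⟩ := hN χ hχ
    obtain ⟨F, hF, hFl, c, hc⟩ := h₁ (fun f => χ (F₁ ∘ f))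
      (fun F G hFG => hχ _ _ (hFG.comp_left F₁))
    rcases lt_or_ge (M + 1) n with hn | hn
    · refine ⟨F₁, hF₁, ?_, c, fun i hi g hg hgn => ?_⟩
      · obtain rfl : M = N₁ := by rw [← hFl, lv_of_mem_MFix hF (by omega)]
        exact hF₁l
      · have := le_lv hg.1 n
        omega
    -- Tightness sends level `M + 1` exactly to `N₁ + 1`, the level that `F₁` has made
    -- monochromatic.
    obtain ⟨F₂, hF₂, hag, hlv⟩ := exists_tight_MFix (m := M) hn hF
    have hF₂M : S.lv F₂ (M + 1) = N₁ + 1 := by rw [hlv, hFl]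
    refine ⟨F₁ ∘ F₂, comp_mem_MFix hF₁ hF₂, ?_, fun i => if i ≤ M then c i else c₁,
      fun i hi g hg hgn => ?_⟩
    · rw [lv_comp hF₁.1, hF₂M, hF₁l]
    · by_cases hiM : i ≤ M
      · simp only [hiM, if_true]
        rw [← hc i hiM g hg hgn]
        refine hχ _ _ ((hag.symm.comp_right hg.1 (fun j hj => ?_)).comp_left F₁)
        have := (lv_strictMono hg.1).monotone (Nat.le_of_lt_succ hj)
        omega
      · simp only [hiM, if_false]
        obtain rfl : i = M + 1 := by omega
        refine hc₁ (F₂ ∘ g) (comp_mem_MFix hF₂ hg) ?_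
        rw [lv_comp hF₂.1, hgn, hF₂M]

/-- If level `n` can be moved, then it can be moved to all higher levels. -/
theorem exists_shift {n : ℕ} {D : T → T} (hD : D ∈ S.MFix n) (hDn : S.lv D n ≠ n) {j : ℕ}
    (hj : n ≤ j) (t : ℕ) : ∃ F ∈ S.MFix j, S.lv F j = j + t := by
  have h1 : ∃ F ∈ S.MFix j, ∀ i, S.lv F (j + i) = j + 1 + i := by
    rcases hj.eq_or_lt with rfl | hj
    -- When `j = n` there may be no lower level to duplicate, so the shift by one is extracted from
    -- `D`; above `n`, level 0 can be duplicated.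
    · have := le_lv hD.1 n
      obtain ⟨-, -, e, he, -, hen, -, hag⟩ := exists_decomp hD.1 (n := n) (p := n + 1) (by omega)
        (fun i hi => by rw [lv_of_mem_MFix hD hi]; omega)
      obtain ⟨e', he', -, hlv⟩ :=
        exists_tight_MFix (m := n) (by omega) (mem_MFix_of_agree le_rfl hD he hag)
      exact ⟨e', he', fun i => by rw [hlv, hen]⟩
    · have hj0 : 0 < j := by omega
      exact ⟨S.dup 0 j, dup_mem_MFix hj0, fun i => by rw [lv_dup_add hj0]; omega⟩
  obtain ⟨F, hF, hlv⟩ := h1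
  induction t with
  | zero => exact ⟨id, id_mem_MFix j, lv_id j⟩
  | succ t ih =>
    obtain ⟨G, hG, hGl⟩ := ih
    refine ⟨F ∘ G, comp_mem_MFix hF hG, ?_⟩
    rw [lv_comp hF.1, hGl, hlv]
    omega

theorem exists_into_levels {n : ℕ} {D : T → T} (hD : D ∈ S.MFix n) (hDn : S.lv D n ≠ n) (t : ℕ) :
    ∀ (p : ℕ) (J : Finset ℕ), n ≤ p → (∀ j ∈ J, n ≤ j ∧ j < p) → t ≤ J.card →
      ∃ F ∈ S.MFix n, S.lv F (n + t) = p ∧ ∀ i < t, S.lv F (n + i) ∈ J := by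
  induction t with
  | zero =>
    intro p J hp _ _
    obtain ⟨F, hF, hFl⟩ := exists_shift hD hDn (le_refl n) (p - n)
    exact ⟨F, hF, by rw [add_zero, hFl]; omega, fun i hi => by omega⟩
  | succ t ih =>
    intro p J hp hJ hc
    have hne : J.Nonempty := Finset.card_pos.1 (by omega)
    have hmem := J.max'_mem hne
    obtain ⟨h1, h2⟩ := hJ _ hmem
    obtain ⟨F, hF, hFl, hFJ⟩ := ih (J.max' hne) (J.erase (J.max' hne)) h1
      (fun j hj => ⟨(hJ j (Finset.mem_of_mem_erase hj)).1,
        lt_of_le_of_ne (J.le_max' j (Finset.mem_of_mem_erase hj)) (Finset.ne_of_mem_erase hj)⟩)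
      (by rw [Finset.card_erase_of_mem hmem]; omega)
    -- Level `n + t` already goes to the maximum of `J`. Tightness puts the next level just above
    -- it, and `G` moves that level to `p` without disturbing the lower images.
    obtain ⟨F', hF', hag, hlv⟩ := exists_tight_MFix (m := n + t) (by omega) hF
    obtain ⟨G, hG, hGl⟩ := exists_shift hD hDn (show n ≤ J.max' hne + 1 by omega)
      (p - (J.max' hne + 1))
    refine ⟨G ∘ F', comp_mem_MFix (MFix_mono (by omega) hG) hF', ?_, fun i hi => ?_⟩
    · rw [lv_comp hG.1, show n + (t + 1) = n + t + 1 by omega, hlv, hFl, hGl]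
      omega
    · rw [lv_comp hG.1, ← lv_congr hag (by omega)]
      have h3 : S.lv F (n + i) ∈ J ∧ S.lv F (n + i) < J.max' hne + 1 := by
        rcases Nat.lt_succ_iff_lt_or_eq.1 hi with hi | rfl
        · have := Finset.mem_of_mem_erase (hFJ i hi)
          exact ⟨this, Nat.lt_succ_of_le (J.le_max' _ this)⟩
        · rw [hFl]
          exact ⟨hmem, Nat.lt_succ_self _⟩
      rw [lv_of_mem_MFix hG h3.2]
      exact h3.1

/-- The one-dimensional pigeonhole principle, with one colour for all levels below `m`. -/
theorem exists_mono_lt (S : SMTree T A) (n m : ℕ) (κ : Type) [Finite κ] : ∃ N : ℕ,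
    ∀ χ : (T → T) → κ, (∀ F G, Agree (n + 1) F G → χ F = χ G) →
      ∃ F ∈ S.MFix n, S.lv F m = N ∧
        ∃ c, ∀ g ∈ S.MFix n, S.lv g n < m → χ (F ∘ g) = c := by
  by_cases hD : ∃ D ∈ S.MFix n, S.lv D n ≠ n
  swap
  · push Not at hD
    exact ⟨m, fun χ hχ => ⟨id, id_mem_MFix n, lv_id m, χ id,
      fun g hg _ => hχ _ _ (agree_id_of_lv hg (hD g hg))⟩⟩
  obtain ⟨D, hD, hDn⟩ := hD
  rcases lt_or_ge m n with hmn | hmn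
  · refine ⟨m, fun χ hχ => ⟨id, id_mem_MFix n, lv_id m, χ id, fun g hg hgm => ?_⟩⟩
    have := le_lv hg.1 n
    omega
  obtain ⟨t, rfl⟩ := Nat.exists_eq_add_of_le hmn
  have := Fintype.ofFinite κ
  classical
  -- Among `card κ * t` levels, `t` share a colour; the levels from `n` to `n + t - 1` are then
  -- mapped into those.
  obtain ⟨N, hN⟩ := S.exists_mono_each_level n (n + Fintype.card κ * t) κ
  refine ⟨N, fun χ hχ => ?_⟩
  have : Nonempty κ := ⟨χ id⟩
  obtain ⟨F, hF, hFl, c, hc⟩ := hN χ hχ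
  obtain ⟨y, -, hy⟩ := Finset.exists_le_card_fiber_of_mul_le_card_of_maps_to
    (s := Finset.Ico n (n + Fintype.card κ * t)) (t := Finset.univ) (f := c) (n := t)
    (fun _ _ => Finset.mem_univ _) Finset.univ_nonempty (by simp)
  obtain ⟨G, hG, hGl, hGJ⟩ := exists_into_levels hD hDn t (n + Fintype.card κ * t) _ (by omega)
    (fun j hj => Finset.mem_Ico.1 (Finset.mem_filter.1 hj).1) hy
  refine ⟨F ∘ G, comp_mem_MFix hF hG, by rw [lv_comp hF.1, hGl, hFl], y, fun g hg hgn => ?_⟩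
  obtain ⟨i, hi⟩ := Nat.exists_eq_add_of_le (le_lv hg.1 n)
  have hJ := Finset.mem_filter.1 (hGJ i (by omega))
  rw [← hJ.2]
  refine hc _ (Finset.mem_Ico.1 hJ.1).2.le (G ∘ g) (comp_mem_MFix hG hg) ?_
  rw [lv_comp hG.1, hi]

/-! ### Induction on the number of levels. -/

/-- The conclusion of the finite Ramsey theorem for functions on `T(≤n+k)`. -/
def RamseyAt (S : SMTree T A) (k : ℕ) : Prop :=
  ∀ (n M : ℕ) (κ : Type) [Finite κ], ∃ N : ℕ,
    ∀ χ : (T → T) → κ, (∀ F G, Agree (n + k + 1) F G → χ F = χ G) →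
      ∃ F ∈ S.MFix n, S.lv F M = N ∧
        ∃ c, ∀ g ∈ S.MFix n, S.lv g (n + k) = M → χ (F ∘ g) = c

/-- The possible images `n + t` of level `n` are treated one by one. Functions that agree with a
representative `e x` on `T(≤ n)` factor as `h ∘ e x` with `h` fixing `T(≤ n + t)`; colouring `h` by
the vector of colours over all `x` leaves one level fewer to control, so `RamseyAt k` applies. -/
theorem RamseyAt.exists_end_homogeneous {k : ℕ} (hk : S.RamseyAt k) (n : ℕ) (κ : Type) [Finite κ]
    (t : ℕ) : ∀ M : ℕ, ∃ N : ℕ, ∀ χ : (T → T) → κ,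
      (∀ F G, Agree (n + k + 2) F G → χ F = χ G) → ∃ H ∈ S.MFix n, S.lv H M = N ∧
        ∀ f ∈ S.MFix n, ∀ f' ∈ S.MFix n, S.lv f (n + k + 1) = M → S.lv f' (n + k + 1) = M →
          S.lv f n < n + t → Agree (n + 1) f f' → χ (H ∘ f) = χ (H ∘ f') := by
  induction t with
  | zero =>
    intro M
    refine ⟨M, fun χ _ => ⟨id, id_mem_MFix n, lv_id M, fun f hf f' _ _ _ h => ?_⟩⟩
    have := le_lv hf.1 n
    omega
  | succ t ih =>
    intro M
    obtain ⟨q, e, he, hrep⟩ := S.exists_reps n (n + t)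
    obtain ⟨M₁, h₁⟩ := hk (n + t + 1) M (Fin q → κ)
    obtain ⟨N, hN⟩ := ih M₁
    refine ⟨N, fun χ hχ => ?_⟩
    obtain ⟨H₁, hH₁, hH₁l, hH₁e⟩ := hN χ hχ
    obtain ⟨H₂, hH₂, hH₂l, c, hc⟩ := h₁ (fun h x => χ (H₁ ∘ h ∘ e x)) (by
      intro F G hFG
      funext x
      refine hχ _ _ ((hFG.comp_right (he x).1.1 (fun i hi => ?_)).comp_left H₁)
      have h2 := (lv_strictMono (he x).1.1).monotone
        (show i ≤ n + (k + 1) by omega)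
      rw [(he x).2] at h2
      omega)
    have hH₂n : H₂ ∈ S.MFix n := MFix_mono (by omega) hH₂
    refine ⟨H₁ ∘ H₂, comp_mem_MFix hH₁ hH₂n, by rw [lv_comp hH₁.1, hH₂l, hH₁l], ?_⟩
    intro f hf f' hf' hfM hfM' hfn hff
    have hfn' := lv_congr (S := S) hff (Nat.lt_succ_self n)
    rcases Nat.lt_succ_iff_lt_or_eq.1 (show S.lv f n < n + t + 1 by omega) with hlt | heq
    · refine hH₁e (H₂ ∘ f) (comp_mem_MFix hH₂n hf) (H₂ ∘ f') (comp_mem_MFix hH₂n hf')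
        ?_ ?_ ?_ (hff.comp_left H₂)
      · rw [lv_comp hH₂.1, hfM, hH₂l]
      · rw [lv_comp hH₂.1, hfM', hH₂l]
      · rw [lv_comp hH₂.1, lv_of_mem_MFix hH₂ (by omega)]
        exact hlt
    · obtain ⟨x, hx⟩ := hrep f hf heq
      have key : ∀ g ∈ S.MFix n, S.lv g (n + k + 1) = M → S.lv g n = n + t →
          Agree (n + 1) g (e x) → χ ((H₁ ∘ H₂) ∘ g) = c x := by
        intro g hg hgM hgn hgx
        obtain ⟨h, hh, hag⟩ := exists_factor hg.1 (he x).1.1 hgx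
          (fun i => by rw [(he x).2, hgn]) (k + 1)
        rw [hgn] at hh
        rw [← hc h hh ?_]
        · exact hχ _ _ (hag.comp_left (H₁ ∘ H₂))
        · rw [← hgM, lv_congr (S := S) (i := n + k + 1) hag (by omega), lv_comp hh.1,
            show n + k + 1 = n + (k + 1) by omega, (he x).2]
          congr 1
          omega
      rw [key f hf hfM heq hx, key f' hf' hfM' (by omega) (hff.symm.trans hx)]

theorem ramseyAt (S : SMTree T A) (k : ℕ) : S.RamseyAt k := by
  induction k with
  | zero => exact fun n M κ _ => S.exists_mono_level n M κ
  | succ k ih =>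
    intro n m κ _
    obtain ⟨M, hM⟩ := S.exists_mono_lt n m κ
    -- The bound `M + 1` covers all relevant functions: level `n` cannot go above the image `M` of
    -- level `n + k + 1`.
    obtain ⟨N, hN⟩ := ih.exists_end_homogeneous n κ (M + 1) M
    refine ⟨N, fun χ hχ => ?_⟩
    obtain ⟨H, hH, hHl, hHe⟩ := hN χ hχ
    let R : (T → T) → Set (T → T) :=
      fun f => {g | g ∈ S.MFix n ∧ S.lv g (n + k + 1) = M ∧ Agree (n + 1) g f}
    classical
    -- The induced colour of `f` is read off from a chosen member of its class `R f`, hence depends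
    -- only on `f` on `T(≤ n)`; `χ id` is a dummy value for empty classes.
    let φ : Set (T → T) → κ := fun s => if h : s.Nonempty then χ (H ∘ h.some) else χ id
    have hφ : ∀ f ∈ S.MFix n, S.lv f (n + k + 1) = M → φ (R f) = χ (H ∘ f) := by
      intro f hf hfM
      have hne : (R f).Nonempty := ⟨f, hf, hfM, fun _ _ => rfl⟩
      obtain ⟨h1, h2, h3⟩ := hne.some_mem
      simp only [φ, dif_pos hne]
      refine hHe _ h1 f hf h2 hfM ?_ h3
      have := (lv_strictMono h1.1).monotone (show n ≤ n + k + 1 by omega)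
      omega
    obtain ⟨F, hF, hFl, c, hc⟩ := hM (fun f => φ (R f)) (by
      intro f g hfg
      have : R f = R g := by
        ext x
        exact ⟨fun h => ⟨h.1, h.2.1, h.2.2.trans hfg⟩,
          fun h => ⟨h.1, h.2.1, h.2.2.trans hfg.symm⟩⟩
      simp only [this])
    refine ⟨H ∘ F, comp_mem_MFix hH hF, by rw [lv_comp hH.1, hFl, hHl], c, fun g hg hgm => ?_⟩
    have hgn := lv_strictMono hg.1 (show n < n + (k + 1) by omega)
    rw [← hc g hg (by omega), hφ (F ∘ g) (comp_mem_MFix hF hg)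
      (by rw [lv_comp hF.1, add_assoc, hgm, hFl])]
    rfl

/-! ### Passage to restrictions. -/

theorem mem_AMAt_iff {n k N : ℕ} (h : 0 < n + k) {f : Below T (n + k) → T} :
    f ∈ S.AMAt n k N ↔ ∃ F ∈ S.MFix n, S.lv F (n + k - 1) = N ∧ ∀ a : Below T (n + k), f a = F a := by
  constructor
  · rintro ⟨⟨F, hF, hf⟩, a, ha, rfl⟩
    refine ⟨F, hF, ?_, hf⟩
    rw [hf, level_map hF.1]
    congr 1
    omega
  · rintro ⟨F, hF, rfl, hf⟩
    obtain ⟨a, ha⟩ := S.exists_level (n + k - 1)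
    refine ⟨⟨F, hF, hf⟩, ⟨a, by omega⟩, by simp only; omega, ?_⟩
    rw [hf, level_map hF.1, ha]

/-- The finite Ramsey theorem, for colourings of functions on `T` that depend on `T(<n+k)` only. -/
theorem exists_ramsey (S : SMTree T A) {n k M : ℕ} (hk : 0 < n + k) (r : ℕ) : ∃ N : ℕ,
    ∀ χ : (T → T) → Fin r, (∀ F G, Agree (n + k) F G → χ F = χ G) →
      ∃ F ∈ S.MFix n, S.lv F M = N ∧
        ∃ c, ∀ g ∈ S.MFix n, S.lv g (n + k - 1) = M → χ (F ∘ g) = c := by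
  cases k with
  | zero =>
    -- With `k = 0` every `g` is the identity on the part of the tree that `χ` sees.
    exact ⟨M, fun χ hχ => ⟨id, id_mem_MFix n, lv_id M, χ id, fun g hg _ => hχ _ _ hg.2⟩⟩
  | succ k => exact S.ramseyAt k n M (Fin r)

end SMTree

end ShapeRamsey

theorem mainTheorem5 {T : Type*} [PartialOrder T] {A : Type*} (S : ShapeRamsey.SMTree T A)
    (n k m r : ℕ) (hk : 0 < n + k) (hm : 0 < n + m) :
    ∃ N : ℕ, ∀ χ : S.AMAt n k N → Fin r,
      ∃ F ∈ S.AMAt n m N, ∃ c : Fin r, ∀ g ∈ S.AMAt n k (n + m - 1),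
        ∃ (hg : ∀ a, ShapeRamsey.level (g a) < n + m)
          (hFg : (fun a => F ⟨g a, hg a⟩) ∈ S.AMAt n k N),
          χ ⟨fun a => F ⟨g a, hg a⟩, hFg⟩ = c := by
  open ShapeRamsey SMTree in
  rcases Nat.eq_zero_or_pos r with rfl | hr
  -- For this `N` the coloured set contains the identity, so no colouring with zero colours exists.
  · refine ⟨n + k - 1, fun χ => Fin.elim0 (χ ⟨fun a => a, ?_⟩)⟩
    exact (mem_AMAt_iff hk).2 ⟨id, id_mem_MFix n, lv_id _, fun _ => rfl⟩
  obtain ⟨N, hN⟩ := S.exists_ramsey (M := n + m - 1) hk r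
  refine ⟨N, fun χ => ?_⟩
  classical
  let ρ : (T → T) → Below T (n + k) → T := fun F a => F a
  -- The colouring is extended to all functions through restriction, with colour 0 outside `AMAt n k
  -- N`; the compositions in question never take that default.
  obtain ⟨F, hF, hFl, c, hc⟩ := hN
    (fun F => if h : ρ F ∈ S.AMAt n k N then χ ⟨ρ F, h⟩ else ⟨0, hr⟩) (by
      intro F G hFG
      have : ρ F = ρ G := funext fun a => hFG a a.2
      simp only [this])
  refine ⟨fun a => F a, (mem_AMAt_iff hm).2 ⟨F, hF, hFl, fun _ => rfl⟩, c, fun g hg => ?_⟩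
  obtain ⟨G, hG, hGl, hgG⟩ := (mem_AMAt_iff hk).1 hg
  have hρ : ρ (F ∘ G) = fun a => F (g a) := funext fun a => by simp only [ρ, hgG]; rfl
  have hmem : ρ (F ∘ G) ∈ S.AMAt n k N :=
    (mem_AMAt_iff hk).2 ⟨F ∘ G, comp_mem_MFix hF hG, by rw [lv_comp hF.1, hGl, hFl], fun _ => rfl⟩
  have hcG := hc G hG hGl
  simp only [dif_pos hmem] at hcG
  refine ⟨fun a => ?_, hρ ▸ hmem, ?_⟩
  · rw [hgG, level_map hG.1]
    have := (lv_strictMono hG.1).monotone (show level a.1 ≤ n + k - 1 by have := a.2; omega)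
    omega
  · rw [← hcG]
    congr 2
    exact hρ.symm
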